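/- **Setting.** Let $\mathcal X,\mathcal V,\mathcal W$ be real Hilbert spaces, where $\mathcal X$ consists of real functions (modulo null sets) on a set $\Omega\subseteq\mathbb R^d$. Let $\mathcal L:\mathcal X\to\mathcal V$ and $\mathcal B:\mathcal X\to\mathcal W$ be bounded linear operators such that for all $f\in\mathcal V$, $g\in\mathcal W$ the problem $\mathcal L[u]=f$, $\mathcal B[u]=g$ has a unique solution $u\in\mathcal X$, and $\|u\|_{\mathcal X}\le C(\|f\|_{\mathcal V}+\|g\|_{\mathcal W})$ with $C$ independent of $f,g$. For fixed $\delta\ge1$ put $$a(u,v)=(\mathcal L[u],\mathcal L[v])_{\mathcal V}+\delta(\mathcal B[u],\mathcal B[v])_{\mathcal W},\quad F(v)=(f,\mathcal L[v])_{\mathcal V}+\delta(g,\mathcal B[v])_{\mathcal W},\quad |||v|||=a(v,v)^{1/2},$$ let $u\in\mathcal X$ satisfy $a(u,v)=F(v)$ for all $v\in\mathcal X$, and write $\langle r(w),v\rangle=F(v)-a(w,v)$. For $\sigma:\mathbb R\to\mathbb R$, $L\in\mathbb N$ and $\mathbf n\in\mathbb N^L$, let $V^{\sigma}_{\mathbf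 n,L}$ be the set of $v\in\mathcal X$ of the form $v(x)=(\sigma\circ\mathbf T_L\circ\dots\circ\sigma\circ\mathbf T_1)(x)\cdot\mathbf c$ with $\mathbf T_j(t)=t\cdot\mathbf W^{(j)}+\mathbf b^{(j)}$, where $\mathbf W^{(j)}\in\mathbb R^{n_{j-1}\times n_j}$, $n_0=d$; and let $V^{\sigma,C}_{\mathbf n,L}$ be the subset of those realized with $\sum_{j}(\|\mathbf W^{(j)}\|_\infty+\|\mathbf b^{(j)}\|_\infty)+\|\mathbf c\|_\infty\le C$ ($\|\cdot\|_\infty$ being the largest absolute value of an entry). The activation $\sigma$ is called suitable at depth $L$ if $\bigcup_{\mathbf n}V^{\sigma}_{\mathbf n,L}$ is dense in $\mathcal X$. For $\Psi:\mathbb R^d\times\mathbb R\to\mathbb R$ and $\mu\in\mathbb R^{\mathcal M}$ with all $\Psi(\cdot;\mu_j)\in\mathcal X$, let $V^\Psi_{\mathcal M}(\mu)=\{\sum_{j=1}^{\mathcal M}d_j\Psi(\cdot;\mu_j):\mathbf d\in\mathbb R^{\mathcal M}\}$, let $V^{\Psi,C}_{\mathcal M}(\mu)$ be the subset given by $\|\mathbf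 d\|_\infty+\|\mu\|_\infty\le C$, and let $V^\Psi_{\mathcal M}$ be the union of all $V^\Psi_{\mathcal M}(\mu)$. Fix $\lambda\in\mathbb R^{\mathcal M}$ with all $\Psi(\cdot;\lambda_j)\in\mathcal X$. **Iteration.** Start from $u_0=u_{\sigma,0}+u_{\Psi,0}$ with $u_{\sigma,0}\in\mathcal X$, $u_{\Psi,0}\in V^\Psi_{\mathcal M}$. In step $i\ge1$, with depth $L_i$, widths $\mathbf n^{(i)}$ and bounds $C_1^{(i)},C_2^{(i)}$, let $\varphi_i^{NN}=\varphi_{\sigma,i}^{NN}+\varphi_{\Psi,i}^{NN}$ (with $\varphi_{\sigma,i}^{NN}\in V^{\sigma,C_1^{(i)}}_{\mathbf n^{(i)},L_i}$ and $\varphi_{\Psi,i}^{NN}\in V^{\Psi,C_2^{(i)}}_{\mathcal M}(\lambda)$) be a maximizer of $\langle r(u_{i-1}),v\rangle$ over all $v\in V^{\sigma,C_1^{(i)}}_{\mathbf n^{(i)},L_i}+V^{\Psi,C_2^{(i)}}_{\mathcal M}(\lambda)$ with $|||v|||=1$, and let $u_i=u_{\sigma,i}+u_{\Psi,i}$ be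 the solution of $a(u_i,v)=F(v)$ for all $v\in S_i^\Psi$, where $$S_i^\Psi=\mathrm{span}\{u_{\sigma,0}/|||u_0|||,\;u_{\Psi,0}/|||u_0|||,\;\varphi_{\sigma,1}^{NN},\varphi_{\Psi,1}^{NN},\dots,\varphi_{\sigma,i}^{NN},\varphi_{\Psi,i}^{NN}\},$$ $u_{\sigma,i}\in\mathrm{span}\{u_{\sigma,0}/|||u_0|||,\varphi_{\sigma,1}^{NN},\dots,\varphi_{\sigma,i}^{NN}\}$ and $u_{\Psi,i}\in\mathrm{span}\{u_{\Psi,0}/|||u_0|||,\varphi_{\Psi,1}^{NN},\dots,\varphi_{\Psi,i}^{NN}\}$ (terms with $1/|||u_0|||$ being dropped if $u_0=0$). When $u\ne u_{i-1}$ put $\varphi_i=(u-u_{i-1})/|||u-u_{i-1}|||$. **Statement.** Let $\varepsilon>0$ and consider the estimates $$|||u-u_i|||\le|||u-u_0|||\cdot\min\{1,\varepsilon\}^i\qquad(0\le i\le k),\tag{1}$$ $$\text{if }\varepsilon<1:\quad\langle r(u_{i-1}),\varphi_i^{NN}\rangle\le|||u-u_{i-1}|||\le\frac1{1-\varepsilon}\langle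 r(u_{i-1}),\varphi_i^{NN}\rangle\qquad(1\le i\le k).\tag{2}$$ (a) If $k$ steps of the iteration are such that $|||\varphi_i-\varphi_i^{NN}|||\le\varepsilon$ for every $1\le i\le k$ with $u_{i-1}\ne u$, then (1) and (2) hold. (b) Given $u_{\Psi,0}\in V_{\mathcal M}^\Psi$, there are thresholds $\mathbf N(L,e)\in\mathbb N^L$, $c_1(L,e)>0$ and $c_2(e)>0$ for $L\in\mathbb N$, $e\in\mathcal X$, such that for all $f$, $g$ and every decomposition $u=u_\infty+u_\Psi$ with $u_\infty\in\mathcal X$ and $u_\Psi\in V^\Psi_{\mathcal M}(\lambda)$: (1) and (2) hold for any $k$ steps of the iteration started with this $u_{\Psi,0}$ (and any $u_{\sigma,0}$) in which, for each $1\le i\le k$, $\sigma$ is suitable at depth $L_i$, $\mathbf n^{(i)}\ge\mathbf N(L_i,u_\infty-u_{\sigma,i-1})$ componentwise, $C_1^{(i)}\ge c_1(L_i,u_\infty-u_{\sigma,i-1})$ and $C_2^{(i)}\ge c_2(u_\Psi-u_{\Psi,i-1})$. -/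

import Mathlib

open MeasureTheory

noncomputable section

/-! ### The least squares variational problem -/

section LeastSquares

variable {𝒳 𝒱 𝒲 : Type*}
  [NormedAddCommGroup 𝒳] [InnerProductSpace ℝ 𝒳]
  [NormedAddCommGroup 𝒱] [InnerProductSpace ℝ 𝒱]
  [NormedAddCommGroup 𝒲] [InnerProductSpace ℝ 𝒲]

/-- The problem `𝓛[u] = f`, `𝓑[u] = g` has, for all data, a unique solution, which depends
continuously on the data. -/
def WellPosed (𝓛 : 𝒳 →L[ℝ] 𝒱) (𝓑 : 𝒳 →L[ℝ] 𝒲) : Prop :=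
  ∃ C : ℝ, 0 < C ∧ ∀ (f : 𝒱) (g : 𝒲), ∃ u : 𝒳, (𝓛 u = f ∧ 𝓑 u = g) ∧
    (∀ v : 𝒳, 𝓛 v = f ∧ 𝓑 v = g → v = u) ∧ ‖u‖ ≤ C * (‖f‖ + ‖g‖)

/-- The least squares bilinear form `a(u, v) = (𝓛 u, 𝓛 v) + δ (𝓑 u, 𝓑 v)`. -/
def lsForm (𝓛 : 𝒳 →L[ℝ] 𝒱) (𝓑 : 𝒳 →L[ℝ] 𝒲) (δ : ℝ) (u v : 𝒳) : ℝ :=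
  inner ℝ (𝓛 u) (𝓛 v) + δ * inner ℝ (𝓑 u) (𝓑 v)

/-- The least squares linear form `F(v) = (f, 𝓛 v) + δ (g, 𝓑 v)`. -/
def lsData (𝓛 : 𝒳 →L[ℝ] 𝒱) (𝓑 : 𝒳 →L[ℝ] 𝒲) (δ : ℝ) (f : 𝒱) (g : 𝒲) (v : 𝒳) : ℝ :=
  inner ℝ f (𝓛 v) + δ * inner ℝ g (𝓑 v)

/-- The energy norm `|||v||| = a(v, v)^{1/2}`. -/
def energyNorm (𝓛 : 𝒳 →L[ℝ] 𝒱) (𝓑 : 𝒳 →L[ℝ] 𝒲) (δ : ℝ) (v : 𝒳) : ℝ :=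
  Real.sqrt (lsForm 𝓛 𝓑 δ v v)

/-- The weak residual `⟨r(w), v⟩ = F(v) - a(w, v)`. -/
def weakResidual (𝓛 : 𝒳 →L[ℝ] 𝒱) (𝓑 : 𝒳 →L[ℝ] 𝒲) (δ : ℝ) (f : 𝒱) (g : 𝒲) (w v : 𝒳) : ℝ :=
  lsData 𝓛 𝓑 δ f g v - lsForm 𝓛 𝓑 δ w v

/-- `u` solves `a(u, v) = F(v)` for all `v ∈ 𝒳`. -/
def IsLSSolution (𝓛 : 𝒳 →L[ℝ] 𝒱) (𝓑 : 𝒳 →L[ℝ] 𝒲) (δ : ℝ) (f : 𝒱) (g : 𝒲) (u : 𝒳) : Prop :=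
  ∀ v : 𝒳, lsForm 𝓛 𝓑 δ u v = lsData 𝓛 𝓑 δ f g v

/-- The normalized error `(u - w) / |||u - w|||`. -/
def normalizedError (𝓛 : 𝒳 →L[ℝ] 𝒱) (𝓑 : 𝒳 →L[ℝ] 𝒲) (δ : ℝ) (u w : 𝒳) : 𝒳 :=
  (energyNorm 𝓛 𝓑 δ (u - w))⁻¹ • (u - w)

end LeastSquares

/-! ### Feedforward neural networks -/

/-- The layer sizes `n₀ = d, n₁, …, n_L`. -/
def layerWidth (d : ℕ) {L : ℕ} (n : Fin L → ℕ) : Fin (L + 1) → ℕ :=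
  Fin.cons d n

/-- Parameters `(W, b, c)` of a network on `ℝ^d` with `L` hidden layers of widths `n`. -/
structure NetParams (d : ℕ) {L : ℕ} (n : Fin L → ℕ) where
  W : (j : Fin L) → Matrix (Fin (layerWidth d n j.castSucc)) (Fin (layerWidth d n j.succ)) ℝ
  b : (j : Fin L) → Fin (layerWidth d n j.succ) → ℝ
  c : Fin (layerWidth d n (Fin.last L)) → ℝ

namespace NetParams

variable {d L : ℕ} {n : Fin L → ℕ}

/-- The output of layer `j`; layer `j + 1` is `t ↦ σ(t · W + b)` applied to layer `j`. -/
def layer (p : NetParams d n) (σ : ℝ → ℝ) (x : Fin d → ℝ) :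
    (j : Fin (L + 1)) → Fin (layerWidth d n j) → ℝ :=
  Fin.induction (motive := fun j => Fin (layerWidth d n j) → ℝ) x
    (fun j t k => σ (Matrix.vecMul t (p.W j) k + p.b j k))

/-- The realization `x ↦ (σ ∘ T_L ∘ ⋯ ∘ σ ∘ T₁)(x) · c`. -/
def realize (p : NetParams d n) (σ : ℝ → ℝ) (x : Fin d → ℝ) : ℝ :=
  p.layer σ x (Fin.last L) ⬝ᵥ p.c

/-- `∑ⱼ (‖W⁽ʲ⁾‖_∞ + ‖b⁽ʲ⁾‖_∞) + ‖c‖_∞`, with `‖·‖_∞` the largest absolute value of an entry. -/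
def paramNorm (p : NetParams d n) : ℝ :=
  ∑ j : Fin L,
    (‖fun q : Fin (layerWidth d n j.castSucc) × Fin (layerWidth d n j.succ) => p.W j q.1 q.2‖
      + ‖p.b j‖) + ‖p.c‖

end NetParams

/-! ### Sets of networks and of knowledge-based functions

`𝒳` is a space of (classes modulo null sets of) real functions on `Ω ⊆ ℝ^d`; the injective linear
map `ι` sends an element of `𝒳` to the function that it is. -/

section FunctionSets

variable {d : ℕ} {Ω : Set (Fin d → ℝ)} {𝒳 : Type*}
  [NormedAddCommGroup 𝒳] [InnerProductSpace ℝ 𝒳]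

/-- `v ∈ 𝒳` is the function `h` on `Ω`. -/
def IsFunction (ι : 𝒳 →ₗ[ℝ] ((Fin d → ℝ) →ₘ[volume.restrict Ω] ℝ)) (v : 𝒳)
    (h : (Fin d → ℝ) → ℝ) : Prop :=
  (ι v : (Fin d → ℝ) → ℝ) =ᵐ[volume.restrict Ω] h

/-- `V_{n,L}^σ`: the elements of `𝒳` realized by a network with widths `n`. -/
def networkSet (ι : 𝒳 →ₗ[ℝ] ((Fin d → ℝ) →ₘ[volume.restrict Ω] ℝ)) (σ : ℝ → ℝ)
    {L : ℕ} (n : Fin L → ℕ) : Set 𝒳 :=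
  {v | ∃ p : NetParams d n, IsFunction ι v (p.realize σ)}

/-- `V_{n,L}^{σ,C}`: the parameters are bounded by `C`. -/
def boundedNetworkSet (ι : 𝒳 →ₗ[ℝ] ((Fin d → ℝ) →ₘ[volume.restrict Ω] ℝ)) (σ : ℝ → ℝ)
    {L : ℕ} (n : Fin L → ℕ) (C : ℝ) : Set 𝒳 :=
  {v | ∃ p : NetParams d n, IsFunction ι v (p.realize σ) ∧ p.paramNorm ≤ C}

/-- The activation function `σ` is suitable for `𝒳` at depth `L`: the networks with `L` hidden
layers, of all widths, are dense in `𝒳`. -/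
def SuitableActivation (ι : 𝒳 →ₗ[ℝ] ((Fin d → ℝ) →ₘ[volume.restrict Ω] ℝ)) (σ : ℝ → ℝ)
    (L : ℕ) : Prop :=
  Dense (⋃ n : Fin L → ℕ, networkSet ι σ n)

/-- `𝓘_Φ = {μ : Φ(·; μ) ∈ 𝒳}`. -/
def admissibleParams (ι : 𝒳 →ₗ[ℝ] ((Fin d → ℝ) →ₘ[volume.restrict Ω] ℝ))
    (Φ : (Fin d → ℝ) → ℝ → ℝ) : Set ℝ :=
  {μ | ∃ v : 𝒳, IsFunction ι v (fun x => Φ x μ)}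

/-- `V_m^Φ(μ)`: the combinations `∑ⱼ dⱼ Φ(·; μⱼ)` with fixed `μ`. -/
def fixedKnowledgeSet (ι : 𝒳 →ₗ[ℝ] ((Fin d → ℝ) →ₘ[volume.restrict Ω] ℝ))
    (Φ : (Fin d → ℝ) → ℝ → ℝ) {m : ℕ} (μ : Fin m → ℝ) : Set 𝒳 :=
  {v | ∃ c : Fin m → ℝ, IsFunction ι v (fun x => ∑ j, c j * Φ x (μ j))}

/-- `V_m^{Φ,C}(μ)`: moreover `‖d‖_∞ + ‖μ‖_∞ ≤ C`. -/
def boundedFixedKnowledgeSet (ι : 𝒳 →ₗ[ℝ] ((Fin d → ℝ) →ₘ[volume.restrict Ω] ℝ))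
    (Φ : (Fin d → ℝ) → ℝ → ℝ) {m : ℕ} (μ : Fin m → ℝ) (C : ℝ) : Set 𝒳 :=
  {v | ∃ c : Fin m → ℝ, IsFunction ι v (fun x => ∑ j, c j * Φ x (μ j)) ∧ ‖c‖ + ‖μ‖ ≤ C}

/-- `V_m^Φ`: the union of the `V_m^Φ(μ)` over `μ ∈ 𝓘_Φ^m`. -/
def knowledgeSet (ι : 𝒳 →ₗ[ℝ] ((Fin d → ℝ) →ₘ[volume.restrict Ω] ℝ))
    (Φ : (Fin d → ℝ) → ℝ → ℝ) (m : ℕ) : Set 𝒳 :=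
  {v | ∃ μ : Fin m → ℝ, (∀ j, μ j ∈ admissibleParams ι Φ) ∧ v ∈ fixedKnowledgeSet ι Φ μ}

end FunctionSets

/-! ### The extended Galerkin neural network iteration -/

section Iteration

variable {d : ℕ} {Ω : Set (Fin d → ℝ)} {𝒳 𝒱 𝒲 : Type*}
  [NormedAddCommGroup 𝒳] [InnerProductSpace ℝ 𝒳]
  [NormedAddCommGroup 𝒱] [InnerProductSpace ℝ 𝒱]
  [NormedAddCommGroup 𝒲] [InnerProductSpace ℝ 𝒲]

/-- The hyperparameters and iterates of the method. For `i ≥ 1`, step `i` uses depth `L i`, widths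
`n i` and parameter bounds `C₁ i`, `C₂ i`; its basis function is `φσ i + φΨ i`, and `uσ i + uΨ i`
is the `i`-th approximation. The entries with index `0` of `L, n, C₁, C₂, φσ, φΨ` are not used. -/
structure XGNN (𝒳 : Type*) where
  L : ℕ → ℕ
  n : (i : ℕ) → Fin (L i) → ℕ
  C₁ : ℕ → ℝ
  C₂ : ℕ → ℝ
  φσ : ℕ → 𝒳
  φΨ : ℕ → 𝒳
  uσ : ℕ → 𝒳
  uΨ : ℕ → 𝒳

namespace XGNN

/-- The approximation `u_i = u_{σ,i} + u_{Ψ,i}`. -/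
def u (R : XGNN 𝒳) (i : ℕ) : 𝒳 := R.uσ i + R.uΨ i

/-- The basis function `φ_i^NN = φ_{σ,i}^NN + φ_{Ψ,i}^NN`. -/
def φNN (R : XGNN 𝒳) (i : ℕ) : 𝒳 := R.φσ i + R.φΨ i

/-- `span {u_{σ,0} / |||u₀|||, φ_{σ,1}, …, φ_{σ,i}}`. -/
def Sσ (R : XGNN 𝒳) (𝓛 : 𝒳 →L[ℝ] 𝒱) (𝓑 : 𝒳 →L[ℝ] 𝒲) (δ : ℝ) (i : ℕ) : Submodule ℝ 𝒳 :=
  Submodule.span ℝ (insert ((energyNorm 𝓛 𝓑 δ (R.u 0))⁻¹ • R.uσ 0) (R.φσ '' Set.Icc 1 i))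

/-- `span {u_{Ψ,0} / |||u₀|||, φ_{Ψ,1}, …, φ_{Ψ,i}}`. -/
def SΨ (R : XGNN 𝒳) (𝓛 : 𝒳 →L[ℝ] 𝒱) (𝓑 : 𝒳 →L[ℝ] 𝒲) (δ : ℝ) (i : ℕ) : Submodule ℝ 𝒳 :=
  Submodule.span ℝ (insert ((energyNorm 𝓛 𝓑 δ (R.u 0))⁻¹ • R.uΨ 0) (R.φΨ '' Set.Icc 1 i))

/-- The space `S_i^Ψ`, spanned by both families. -/
def S (R : XGNN 𝒳) (𝓛 : 𝒳 →L[ℝ] 𝒱) (𝓑 : 𝒳 →L[ℝ] 𝒲) (δ : ℝ) (i : ℕ) : Submodule ℝ 𝒳 :=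
  R.Sσ 𝓛 𝓑 δ i ⊔ R.SΨ 𝓛 𝓑 δ i

/-- The first `k` steps of `R` are produced by the method. -/
structure IsRun (R : XGNN 𝒳) (ι : 𝒳 →ₗ[ℝ] ((Fin d → ℝ) →ₘ[volume.restrict Ω] ℝ))
    (𝓛 : 𝒳 →L[ℝ] 𝒱) (𝓑 : 𝒳 →L[ℝ] 𝒲) (δ : ℝ) (f : 𝒱) (g : 𝒲)
    (σ : ℝ → ℝ) (Ψ : (Fin d → ℝ) → ℝ → ℝ) {M : ℕ} (lam : Fin M → ℝ) (k : ℕ) : Prop where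
  /-- The low-regularity part of the initial approximation is a knowledge-based function. -/
  init : R.uΨ 0 ∈ knowledgeSet ι Ψ M
  /-- The basis function is admissible and has energy norm one. -/
  mem_network : ∀ i, 1 ≤ i → i ≤ k → R.φσ i ∈ boundedNetworkSet ι σ (R.n i) (R.C₁ i)
  mem_knowledge : ∀ i, 1 ≤ i → i ≤ k → R.φΨ i ∈ boundedFixedKnowledgeSet ι Ψ lam (R.C₂ i)
  norm_eq_one : ∀ i, 1 ≤ i → i ≤ k → energyNorm 𝓛 𝓑 δ (R.φNN i) = 1
  /-- It maximizes the weak residual of the previous approximation. -/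
  isMax : ∀ i, 1 ≤ i → i ≤ k → ∀ vσ ∈ boundedNetworkSet ι σ (R.n i) (R.C₁ i),
    ∀ vΨ ∈ boundedFixedKnowledgeSet ι Ψ lam (R.C₂ i), energyNorm 𝓛 𝓑 δ (vσ + vΨ) = 1 →
      weakResidual 𝓛 𝓑 δ f g (R.u (i - 1)) (vσ + vΨ) ≤
        weakResidual 𝓛 𝓑 δ f g (R.u (i - 1)) (R.φNN i)
  /-- The new approximation is the Galerkin approximation from `S_i^Ψ`, with its two parts. -/
  mem_Sσ : ∀ i, 1 ≤ i → i ≤ k → R.uσ i ∈ R.Sσ 𝓛 𝓑 δ i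
  mem_SΨ : ∀ i, 1 ≤ i → i ≤ k → R.uΨ i ∈ R.SΨ 𝓛 𝓑 δ i
  galerkin : ∀ i, 1 ≤ i → i ≤ k → ∀ v ∈ R.S 𝓛 𝓑 δ i,
    lsForm 𝓛 𝓑 δ (R.u i) v = lsData 𝓛 𝓑 δ f g v

end XGNN

end Iteration

end

/-! The energy inner product is the pullback of a Hilbert product along `energyMap`, injective by
well-posedness, and the weak residual is the energy inner product with the error. The Galerkin
solution is therefore the best approximation from `S` in energy norm
(`IsLSSolution.norm_sub_le_of_galerkin`). The spaces `S` are nested and contain the current iterate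
and the new basis function, so correcting the iterate by `|||u - u_{i-1}|||` times that function
shows that closeness `ε` to the normalized error contracts the error by `ε`. Cauchy–Schwarz gives
the residual bounds.

For (b), among unit vectors a larger inner product with the normalized error means a smaller
distance to it. The maximizer is thus within `ε` as soon as one admissible competitor is
(`IsRun.norm_normalizedError_sub_le`), and a pure network suffices as competitor. The whole error
lies in the span of the smooth error `e`, the given `uΨ₀` and the functions `Ψ(·; λ_j)`. This space
is finite-dimensional and depends on neither `f`, `g` nor `uPsi`. Compactness of its energy unit
sphere and density of networks give one architecture and one parameter bound for all errors in it
(`SuitableActivation.exists_uniform_approx`). -/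

noncomputable section

/-! ### The energy inner product -/

section Energy

variable {𝒳 𝒱 𝒲 : Type*}
  [NormedAddCommGroup 𝒳] [InnerProductSpace ℝ 𝒳]
  [NormedAddCommGroup 𝒱] [InnerProductSpace ℝ 𝒱]
  [NormedAddCommGroup 𝒲] [InnerProductSpace ℝ 𝒲]
  {𝓛 : 𝒳 →L[ℝ] 𝒱} {𝓑 : 𝒳 →L[ℝ] 𝒲} {δ : ℝ}

/-- The map `v ↦ (𝓛 v, √δ 𝓑 v)`, along which the energy inner product is pulled back. -/
def energyMap (𝓛 : 𝒳 →L[ℝ] 𝒱) (𝓑 : 𝒳 →L[ℝ] 𝒲) (δ : ℝ) : 𝒳 →L[ℝ] WithLp 2 (𝒱 × 𝒲) :=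
  (WithLp.prodContinuousLinearEquiv 2 ℝ 𝒱 𝒲).symm.toContinuousLinearMap ∘L
    (𝓛.prod (Real.sqrt δ • 𝓑))

theorem lsForm_eq_inner (hδ : 0 ≤ δ) (v w : 𝒳) :
    lsForm 𝓛 𝓑 δ v w = inner ℝ (energyMap 𝓛 𝓑 δ v) (energyMap 𝓛 𝓑 δ w) := by
  simp [lsForm, energyMap, WithLp.prod_inner_apply, inner_smul_left, inner_smul_right,
    ← mul_assoc, Real.mul_self_sqrt hδ]

theorem energyNorm_eq_norm (hδ : 0 ≤ δ) (v : 𝒳) :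
    energyNorm 𝓛 𝓑 δ v = ‖energyMap 𝓛 𝓑 δ v‖ := by
  rw [energyNorm, lsForm_eq_inner hδ, real_inner_self_eq_norm_sq, Real.sqrt_sq (norm_nonneg _)]

/-- An element of the kernel solves the problem with zero data, hence vanishes by uniqueness. -/
theorem WellPosed.energyMap_injective (hwp : WellPosed 𝓛 𝓑) (hδ : 0 < δ) :
    Function.Injective (energyMap 𝓛 𝓑 δ) := by
  rw [injective_iff_map_eq_zero]
  intro v hv
  have h : (𝓛 v, Real.sqrt δ • 𝓑 v) = (0 : 𝒱 × 𝒲) :=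
    (WithLp.prodContinuousLinearEquiv 2 ℝ 𝒱 𝒲).symm.injective (by simpa [energyMap] using hv)
  obtain ⟨h₁, h₂⟩ := Prod.mk_eq_zero.1 h
  have h₃ : 𝓑 v = 0 := (smul_eq_zero.1 h₂).resolve_left (Real.sqrt_pos.2 hδ).ne'
  obtain ⟨C, -, hC⟩ := hwp
  obtain ⟨u, -, hu, -⟩ := hC 0 0
  rw [hu v ⟨h₁, h₃⟩, hu 0 ⟨map_zero _, map_zero _⟩]

theorem IsLSSolution.weakResidual_eq {f : 𝒱} {g : 𝒲} {u : 𝒳} (hu : IsLSSolution 𝓛 𝓑 δ f g u)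
    (hδ : 0 ≤ δ) (w v : 𝒳) :
    weakResidual 𝓛 𝓑 δ f g w v =
      inner ℝ (energyMap 𝓛 𝓑 δ (u - w)) (energyMap 𝓛 𝓑 δ v) := by
  rw [weakResidual, ← hu v, lsForm_eq_inner hδ, lsForm_eq_inner hδ, map_sub, inner_sub_left]

/-- Céa's lemma for the energy norm. -/
theorem IsLSSolution.norm_sub_le_of_galerkin {f : 𝒱} {g : 𝒲} {u : 𝒳}
    (hu : IsLSSolution 𝓛 𝓑 δ f g u) (hδ : 0 ≤ δ) {S : Submodule ℝ 𝒳} {w : 𝒳} (hw : w ∈ S)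
    (hgal : ∀ v ∈ S, lsForm 𝓛 𝓑 δ w v = lsData 𝓛 𝓑 δ f g v) {v : 𝒳} (hv : v ∈ S) :
    ‖energyMap 𝓛 𝓑 δ (u - w)‖ ≤ ‖energyMap 𝓛 𝓑 δ (u - v)‖ := by
  -- Galerkin orthogonality: the residual of `w` vanishes on `S`, which contains `w - v`. Pythagoras
  -- then compares the two errors.
  have horth : inner ℝ (energyMap 𝓛 𝓑 δ (u - w)) (energyMap 𝓛 𝓑 δ (w - v)) = 0 := by
    rw [← hu.weakResidual_eq hδ, weakResidual, hgal _ (S.sub_mem hw hv), sub_self]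
  have hsplit : u - v = (u - w) + (w - v) := by abel
  have hpyth := norm_add_sq_eq_norm_sq_add_norm_sq_of_inner_eq_zero _ _ horth
  rw [← map_add, ← hsplit] at hpyth
  nlinarith [norm_nonneg (energyMap 𝓛 𝓑 δ (u - w)), norm_nonneg (energyMap 𝓛 𝓑 δ (u - v)),
    norm_nonneg (energyMap 𝓛 𝓑 δ (w - v))]

end Energy

/-! ### Estimates for the iteration -/

namespace XGNN

section Estimates

variable {d : ℕ} {Ω : Set (Fin d → ℝ)} {𝒳 𝒱 𝒲 : Type*}
  [NormedAddCommGroup 𝒳] [InnerProductSpace ℝ 𝒳]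
  [NormedAddCommGroup 𝒱] [InnerProductSpace ℝ 𝒱]
  [NormedAddCommGroup 𝒲] [InnerProductSpace ℝ 𝒲]
  {ι : 𝒳 →ₗ[ℝ] ((Fin d → ℝ) →ₘ[volume.restrict Ω] ℝ)}
  {𝓛 : 𝒳 →L[ℝ] 𝒱} {𝓑 : 𝒳 →L[ℝ] 𝒲} {δ : ℝ} {f : 𝒱} {g : 𝒲}
  {σ : ℝ → ℝ} {Ψ : (Fin d → ℝ) → ℝ → ℝ} {M : ℕ} {lam : Fin M → ℝ} {k : ℕ} {R : XGNN 𝒳}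

theorem Sσ_mono (R : XGNN 𝒳) : Monotone (R.Sσ 𝓛 𝓑 δ) := fun _ _ h =>
  Submodule.span_mono (Set.insert_subset_insert (Set.image_mono (Set.Icc_subset_Icc_right h)))

theorem SΨ_mono (R : XGNN 𝒳) : Monotone (R.SΨ 𝓛 𝓑 δ) := fun _ _ h =>
  Submodule.span_mono (Set.insert_subset_insert (Set.image_mono (Set.Icc_subset_Icc_right h)))

theorem S_mono (R : XGNN 𝒳) : Monotone (R.S 𝓛 𝓑 δ) := fun _ _ h =>
  sup_le_sup (R.Sσ_mono h) (R.SΨ_mono h)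

theorem φNN_mem_S (R : XGNN 𝒳) {i : ℕ} (hi : 1 ≤ i) : R.φNN i ∈ R.S 𝓛 𝓑 δ i :=
  Submodule.add_mem_sup
    (Submodule.subset_span (Set.mem_insert_of_mem _ ⟨i, ⟨hi, le_rfl⟩, rfl⟩))
    (Submodule.subset_span (Set.mem_insert_of_mem _ ⟨i, ⟨hi, le_rfl⟩, rfl⟩))

/-- The two scaled generators add up to a nonzero multiple of `R.u 0` unless `R.u 0 = 0`; in that
case the convention `0⁻¹ = 0` makes both generators zero, which amounts to dropping them. -/
theorem u_zero_mem_S (R : XGNN 𝒳) (hwp : WellPosed 𝓛 𝓑) (hδ : 0 < δ) :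
    R.u 0 ∈ R.S 𝓛 𝓑 δ 0 := by
  rcases eq_or_ne (R.u 0) 0 with h0 | h0
  · rw [h0]; exact Submodule.zero_mem _
  have hne : energyNorm 𝓛 𝓑 δ (R.u 0) ≠ 0 := by
    rw [energyNorm_eq_norm hδ.le, norm_ne_zero_iff]
    exact fun h => h0 (hwp.energyMap_injective hδ (h.trans (map_zero _).symm))
  have hscaled : (energyNorm 𝓛 𝓑 δ (R.u 0))⁻¹ • R.u 0 ∈ R.S 𝓛 𝓑 δ 0 := by
    rw [show R.u 0 = R.uσ 0 + R.uΨ 0 from rfl, smul_add]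
    exact Submodule.add_mem_sup (Submodule.subset_span (Set.mem_insert _ _))
      (Submodule.subset_span (Set.mem_insert _ _))
  simpa [smul_smul, mul_inv_cancel₀ hne] using
    Submodule.smul_mem _ (energyNorm 𝓛 𝓑 δ (R.u 0)) hscaled

theorem IsRun.u_mem_S (hR : R.IsRun ι 𝓛 𝓑 δ f g σ Ψ lam k) (hwp : WellPosed 𝓛 𝓑) (hδ : 0 < δ)
    {i : ℕ} (hi : i ≤ k) : R.u i ∈ R.S 𝓛 𝓑 δ i := by
  rcases Nat.eq_zero_or_pos i with rfl | hpos
  · exact R.u_zero_mem_S hwp hδ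
  · exact Submodule.add_mem_sup (hR.mem_Sσ i hpos hi) (hR.mem_SΨ i hpos hi)

/-- One step reduces the energy error at least as much as any multiple of the basis function. -/
theorem IsRun.norm_error_succ_le (hR : R.IsRun ι 𝓛 𝓑 δ f g σ Ψ lam k) (hwp : WellPosed 𝓛 𝓑)
    (hδ : 0 < δ) {u : 𝒳} (hu : IsLSSolution 𝓛 𝓑 δ f g u) {i : ℕ} (hi : i + 1 ≤ k) (t : ℝ) :
    ‖energyMap 𝓛 𝓑 δ (u - R.u (i + 1))‖ ≤
      ‖energyMap 𝓛 𝓑 δ (u - R.u i - t • R.φNN (i + 1))‖ := by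
  rw [sub_sub]
  exact hu.norm_sub_le_of_galerkin hδ.le (hR.u_mem_S hwp hδ hi)
    (hR.galerkin (i + 1) (Nat.le_add_left 1 i) hi)
    (Submodule.add_mem _ (R.S_mono (Nat.le_succ i) (hR.u_mem_S hwp hδ (Nat.le_of_succ_le hi)))
      (Submodule.smul_mem _ _ (R.φNN_mem_S (Nat.le_add_left 1 i))))

theorem energyMap_error_eq (hδ : 0 ≤ δ) (u w : 𝒳) :
    energyMap 𝓛 𝓑 δ (u - w) =
      ‖energyMap 𝓛 𝓑 δ (u - w)‖ • energyMap 𝓛 𝓑 δ (normalizedError 𝓛 𝓑 δ u w) := by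
  rw [normalizedError, map_smul, energyNorm_eq_norm hδ]
  rcases eq_or_ne (energyMap 𝓛 𝓑 δ (u - w)) 0 with h | h
  · simp [h]
  · rw [smul_inv_smul₀ (norm_ne_zero_iff.2 h)]

theorem norm_energyMap_normalizedError (hwp : WellPosed 𝓛 𝓑) (hδ : 0 < δ) {u w : 𝒳}
    (h : w ≠ u) : ‖energyMap 𝓛 𝓑 δ (normalizedError 𝓛 𝓑 δ u w)‖ = 1 := by
  have hne : energyMap 𝓛 𝓑 δ (u - w) ≠ 0 := fun h' =>
    h (sub_eq_zero.1 (hwp.energyMap_injective hδ (h'.trans (map_zero _).symm))).symm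
  rw [normalizedError, map_smul, energyNorm_eq_norm hδ.le, norm_smul, norm_inv, norm_norm,
    inv_mul_cancel₀ (norm_ne_zero_iff.2 hne)]

/-- The multiple `t = 0` gives the factor `1`, and `t` equal to the current energy error gives the
factor `ε`. -/
theorem IsRun.norm_error_succ_le_mul (hR : R.IsRun ι 𝓛 𝓑 δ f g σ Ψ lam k)
    (hwp : WellPosed 𝓛 𝓑) (hδ : 0 < δ) {u : 𝒳} (hu : IsLSSolution 𝓛 𝓑 δ f g u) {ε : ℝ} {i : ℕ}
    (hi : i + 1 ≤ k)
    (hclose : R.u i ≠ u →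
      energyNorm 𝓛 𝓑 δ (normalizedError 𝓛 𝓑 δ u (R.u i) - R.φNN (i + 1)) ≤ ε) :
    ‖energyMap 𝓛 𝓑 δ (u - R.u (i + 1))‖ ≤ ‖energyMap 𝓛 𝓑 δ (u - R.u i)‖ * min 1 ε := by
  have hone : ‖energyMap 𝓛 𝓑 δ (u - R.u (i + 1))‖ ≤ ‖energyMap 𝓛 𝓑 δ (u - R.u i)‖ := by
    simpa using hR.norm_error_succ_le hwp hδ hu hi 0
  rcases eq_or_ne (R.u i) u with h | h
  · simpa [h] using hone
  rw [mul_min_of_nonneg _ _ (norm_nonneg _), mul_one]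
  refine le_min hone
    ((hR.norm_error_succ_le hwp hδ hu hi ‖energyMap 𝓛 𝓑 δ (u - R.u i)‖).trans ?_)
  have hclose' := hclose h
  rw [energyNorm_eq_norm hδ.le, map_sub] at hclose'
  rw [map_sub, map_smul]
  conv_lhs => enter [1, 1]; rw [energyMap_error_eq hδ.le]
  rw [← smul_sub, norm_smul, norm_norm]
  gcongr

theorem IsRun.residual_bounds (hR : R.IsRun ι 𝓛 𝓑 δ f g σ Ψ lam k)
    (hwp : WellPosed 𝓛 𝓑) (hδ : 0 < δ) {u : 𝒳} (hu : IsLSSolution 𝓛 𝓑 δ f g u) {ε : ℝ}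
    (hε : ε < 1) {i : ℕ} (hi : i + 1 ≤ k)
    (hclose : R.u i ≠ u →
      energyNorm 𝓛 𝓑 δ (normalizedError 𝓛 𝓑 δ u (R.u i) - R.φNN (i + 1)) ≤ ε) :
    weakResidual 𝓛 𝓑 δ f g (R.u i) (R.φNN (i + 1)) ≤ energyNorm 𝓛 𝓑 δ (u - R.u i) ∧
      energyNorm 𝓛 𝓑 δ (u - R.u i) ≤
        1 / (1 - ε) * weakResidual 𝓛 𝓑 δ f g (R.u i) (R.φNN (i + 1)) := by
  have hφ := hR.norm_eq_one (i + 1) (Nat.le_add_left 1 i) hi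
  rw [energyNorm_eq_norm hδ.le] at hφ
  rw [hu.weakResidual_eq hδ.le, energyNorm_eq_norm hδ.le]
  refine ⟨(real_inner_le_norm _ _).trans (by rw [hφ, mul_one]), ?_⟩
  rw [one_div, ← div_eq_inv_mul, le_div_iff₀ (sub_pos.2 hε)]
  rcases eq_or_ne (R.u i) u with h | h
  · simp [h]
  have hclose' := hclose h
  rw [energyNorm_eq_norm hδ.le, map_sub] at hclose'
  have hn := norm_energyMap_normalizedError hwp hδ h
  conv_rhs => rw [energyMap_error_eq hδ.le, inner_smul_left]
  refine mul_le_mul_of_nonneg_left ?_ (norm_nonneg _)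
  -- For unit `x`, Cauchy–Schwarz applied to `x` and `x - y` gives `1 - ⟨x, y⟩ ≤ ‖x - y‖ ≤ ε`, so
  -- `⟨x, y⟩ ≥ 1 - ε`.
  have hcs := real_inner_le_norm (energyMap 𝓛 𝓑 δ (normalizedError 𝓛 𝓑 δ u (R.u i)))
    (energyMap 𝓛 𝓑 δ (normalizedError 𝓛 𝓑 δ u (R.u i)) - energyMap 𝓛 𝓑 δ (R.φNN (i + 1)))
  rw [inner_sub_right, real_inner_self_eq_norm_sq, hn, one_mul] at hcs
  linarith

theorem IsRun.estimates (hR : R.IsRun ι 𝓛 𝓑 δ f g σ Ψ lam k) (hwp : WellPosed 𝓛 𝓑)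
    (hδ : 0 < δ) {u : 𝒳} (hu : IsLSSolution 𝓛 𝓑 δ f g u) {ε : ℝ} (hε : 0 < ε)
    (hclose : ∀ i, 1 ≤ i → i ≤ k → R.u (i - 1) ≠ u →
      energyNorm 𝓛 𝓑 δ (normalizedError 𝓛 𝓑 δ u (R.u (i - 1)) - R.φNN i) ≤ ε) :
    (∀ i, i ≤ k →
      energyNorm 𝓛 𝓑 δ (u - R.u i) ≤ energyNorm 𝓛 𝓑 δ (u - R.u 0) * min 1 ε ^ i) ∧
    (ε < 1 → ∀ i, 1 ≤ i → i ≤ k →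
      weakResidual 𝓛 𝓑 δ f g (R.u (i - 1)) (R.φNN i) ≤ energyNorm 𝓛 𝓑 δ (u - R.u (i - 1)) ∧
      energyNorm 𝓛 𝓑 δ (u - R.u (i - 1)) ≤
        1 / (1 - ε) * weakResidual 𝓛 𝓑 δ f g (R.u (i - 1)) (R.φNN i)) := by
  refine ⟨fun i => ?_, fun hε1 i h1 hi => ?_⟩
  · induction i with
    | zero => simp
    | succ i ih =>
      intro hi
      have hstep := hR.norm_error_succ_le_mul hwp hδ hu hi
        (hclose (i + 1) (Nat.le_add_left 1 i) hi)
      have ih' := ih (Nat.le_of_succ_le hi)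
      rw [energyNorm_eq_norm hδ.le, energyNorm_eq_norm hδ.le] at ih' ⊢
      rw [pow_succ, ← mul_assoc]
      exact hstep.trans (mul_le_mul_of_nonneg_right ih' (le_min zero_le_one hε.le))
  · obtain ⟨j, rfl⟩ := Nat.exists_eq_add_of_le' h1
    exact hR.residual_bounds hwp hδ hu hε1 hi (hclose (j + 1) h1 hi)

/-- The basis function is at least as close to the normalized error as any admissible
competitor. -/
theorem IsRun.norm_normalizedError_sub_le (hR : R.IsRun ι 𝓛 𝓑 δ f g σ Ψ lam k)
    (hwp : WellPosed 𝓛 𝓑) (hδ : 0 < δ) {u : 𝒳} (hu : IsLSSolution 𝓛 𝓑 δ f g u) {i : ℕ}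
    (h1 : 1 ≤ i) (hi : i ≤ k) (hne : R.u (i - 1) ≠ u) {vσ vΨ : 𝒳}
    (hσ : vσ ∈ boundedNetworkSet ι σ (R.n i) (R.C₁ i))
    (hΨ : vΨ ∈ boundedFixedKnowledgeSet ι Ψ lam (R.C₂ i))
    (hv : ‖energyMap 𝓛 𝓑 δ (vσ + vΨ)‖ = 1) :
    ‖energyMap 𝓛 𝓑 δ (normalizedError 𝓛 𝓑 δ u (R.u (i - 1))) - energyMap 𝓛 𝓑 δ (R.φNN i)‖ ≤
      ‖energyMap 𝓛 𝓑 δ (normalizedError 𝓛 𝓑 δ u (R.u (i - 1))) -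
        energyMap 𝓛 𝓑 δ (vσ + vΨ)‖ := by
  have hmax := hR.isMax i h1 hi vσ hσ vΨ hΨ (by rw [energyNorm_eq_norm hδ.le, hv])
  have hφ := hR.norm_eq_one i h1 hi
  rw [energyNorm_eq_norm hδ.le] at hφ
  have hpos : 0 < ‖energyMap 𝓛 𝓑 δ (u - R.u (i - 1))‖ := norm_pos_iff.2 fun h' =>
    hne (sub_eq_zero.1 (hwp.energyMap_injective hδ (h'.trans (map_zero _).symm))).symm
  rw [hu.weakResidual_eq hδ.le, hu.weakResidual_eq hδ.le, energyMap_error_eq hδ.le,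
    inner_smul_left, inner_smul_left] at hmax
  have hinner := le_of_mul_le_mul_left hmax hpos
  refine le_of_sq_le_sq ?_ (norm_nonneg _)
  -- Both candidates have norm one, so the squared distances differ only in their inner product
  -- terms.
  rw [norm_sub_sq_real, norm_sub_sq_real, hφ, hv]
  linarith

end Estimates

end XGNN

/-! ### Nesting and scaling of network sets -/

theorem Fin.sum_eq_sum_castLE {a b : ℕ} (h : a ≤ b) (F : Fin b → ℝ)
    (hF : ∀ q : Fin b, a ≤ q → F q = 0) : ∑ q, F q = ∑ q : Fin a, F (Fin.castLE h q) := by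
  symm
  refine Finset.sum_of_injOn (Fin.castLE h) (Fin.castLE_injective h).injOn (by simp) ?_
    (fun _ _ => rfl)
  intro q _ hq
  refine hF q (not_lt.1 fun hlt => hq ?_)
  exact ⟨⟨q, hlt⟩, by simp, by ext; rfl⟩

namespace NetParams

variable {d L : ℕ} {n n' : Fin L → ℕ}

theorem layerWidth_mono (h : n ≤ n') (j : Fin (L + 1)) : layerWidth d n j ≤ layerWidth d n' j := by
  refine Fin.cases ?_ (fun j => ?_) j
  · exact le_rfl
  · exact h j

/-- Extension of a network by neurons without any connections. -/
def pad (p : NetParams d n) (n' : Fin L → ℕ) : NetParams d n' where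
  W j q r :=
    if h : q.1 < layerWidth d n j.castSucc ∧ r.1 < layerWidth d n j.succ then
      p.W j ⟨q, h.1⟩ ⟨r, h.2⟩ else 0
  b j r := if h : r.1 < layerWidth d n j.succ then p.b j ⟨r, h⟩ else 0
  c r := if h : r.1 < layerWidth d n (Fin.last L) then p.c ⟨r, h⟩ else 0

theorem layer_succ (p : NetParams d n) (σ : ℝ → ℝ) (x : Fin d → ℝ) (j : Fin L) :
    p.layer σ x j.succ =
      fun k => σ (Matrix.vecMul (p.layer σ x j.castSucc) (p.W j) k + p.b j k) :=
  Fin.induction_succ _ _ _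

/-- An added neuron outputs `σ 0`, which need not vanish, but all weights leaving it are zero, so
the original neurons are unaffected. -/
theorem pad_layer (p : NetParams d n) (h : n ≤ n') (σ : ℝ → ℝ) (x : Fin d → ℝ) (j : Fin (L + 1)) :
    ∀ q, (p.pad n').layer σ x j (Fin.castLE (layerWidth_mono h j) q) = p.layer σ x j q := by
  induction j using Fin.induction with
  | zero => exact fun q => rfl
  | succ j ih =>
    intro q
    rw [layer_succ, layer_succ]
    refine congrArg σ (congrArg₂ (· + ·) ?_ ?_)
    · simp only [Matrix.vecMul, dotProduct]
      rw [Fin.sum_eq_sum_castLE (layerWidth_mono h j.castSucc)]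
      · refine Finset.sum_congr rfl fun r _ => ?_
        rw [ih]
        simp [pad]
      · intro r hr
        simp [pad, not_lt.2 hr]
    · simp [pad]

theorem pad_realize (p : NetParams d n) (h : n ≤ n') (σ : ℝ → ℝ) :
    (p.pad n').realize σ = p.realize σ := by
  funext x
  simp only [realize, dotProduct]
  rw [Fin.sum_eq_sum_castLE (layerWidth_mono h _)]
  · refine Finset.sum_congr rfl fun r _ => ?_
    rw [p.pad_layer h]
    simp [pad]
  · intro r hr
    simp [pad, not_lt.2 hr]

theorem paramNorm_pad_le (p : NetParams d n) (n' : Fin L → ℕ) :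
    (p.pad n').paramNorm ≤ p.paramNorm := by
  unfold paramNorm
  refine add_le_add (Finset.sum_le_sum fun j _ => add_le_add ?_ ?_) ?_
  · refine (pi_norm_le_iff_of_nonneg (norm_nonneg _)).2 fun q => ?_
    by_cases hq : q.1.1 < layerWidth d n j.castSucc ∧ q.2.1 < layerWidth d n j.succ
    · simp only [pad, dif_pos hq]
      exact norm_le_pi_norm (fun q : Fin (layerWidth d n j.castSucc) ×
        Fin (layerWidth d n j.succ) => p.W j q.1 q.2) (⟨q.1, hq.1⟩, ⟨q.2, hq.2⟩)
    · simp [pad, dif_neg hq]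
  · refine (pi_norm_le_iff_of_nonneg (norm_nonneg _)).2 fun r => ?_
    by_cases hr : r.1 < layerWidth d n j.succ
    · simp only [pad, dif_pos hr]
      exact norm_le_pi_norm (p.b j) ⟨r, hr⟩
    · simp [pad, dif_neg hr]
  · refine (pi_norm_le_iff_of_nonneg (norm_nonneg _)).2 fun r => ?_
    by_cases hr : r.1 < layerWidth d n (Fin.last L)
    · simp only [pad, dif_pos hr]
      exact norm_le_pi_norm p.c ⟨r, hr⟩
    · simp [pad, dif_neg hr]

/-- Multiplication of the output weights by a scalar. -/
def scale (p : NetParams d n) (t : ℝ) : NetParams d n where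
  W := p.W
  b := p.b
  c := t • p.c

theorem scale_realize (p : NetParams d n) (t : ℝ) (σ : ℝ → ℝ) :
    (p.scale t).realize σ = t • p.realize σ := by
  funext x
  exact dotProduct_smul t (p.layer σ x (Fin.last L)) p.c

end NetParams

/-! ### Network and knowledge sets in `𝒳`, and uniform approximation on spheres -/

section Sets

variable {d : ℕ} {Ω : Set (Fin d → ℝ)} {𝒳 : Type*}
  [NormedAddCommGroup 𝒳] [InnerProductSpace ℝ 𝒳]
  {ι : 𝒳 →ₗ[ℝ] ((Fin d → ℝ) →ₘ[volume.restrict Ω] ℝ)}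

theorem IsFunction.zero : IsFunction ι 0 0 := by
  rw [IsFunction, map_zero]
  exact AEEqFun.coeFn_zero

theorem IsFunction.add {v w : 𝒳} {h k : (Fin d → ℝ) → ℝ} (hv : IsFunction ι v h)
    (hw : IsFunction ι w k) : IsFunction ι (v + w) (h + k) := by
  rw [IsFunction, map_add]
  exact (AEEqFun.coeFn_add _ _).trans (Filter.EventuallyEq.add hv hw)

theorem IsFunction.smul {v : 𝒳} {h : (Fin d → ℝ) → ℝ} (t : ℝ) (hv : IsFunction ι v h) :
    IsFunction ι (t • v) (t • h) := by
  rw [IsFunction, map_smul]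
  exact (AEEqFun.coeFn_smul _ _).trans (Filter.EventuallyEq.const_smul hv t)

theorem IsFunction.sum {α : Type*} (s : Finset α) {v : α → 𝒳} {h : α → (Fin d → ℝ) → ℝ}
    (hv : ∀ j ∈ s, IsFunction ι (v j) (h j)) : IsFunction ι (∑ j ∈ s, v j) (∑ j ∈ s, h j) := by
  classical
  induction s using Finset.induction_on with
  | empty => exact IsFunction.zero
  | insert a s ha ih =>
    rw [Finset.sum_insert ha, Finset.sum_insert ha]
    exact (hv a (Finset.mem_insert_self _ _)).add
      (ih fun j hj => hv j (Finset.mem_insert_of_mem hj))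

theorem IsFunction.unique (hι : Function.Injective ι) {v w : 𝒳} {h : (Fin d → ℝ) → ℝ}
    (hv : IsFunction ι v h) (hw : IsFunction ι w h) : v = w :=
  hι (AEEqFun.ext (hv.trans hw.symm))

/-- Padding changes neither the realized function nor increases the parameter norm. This is what
turns a single good architecture into a threshold. -/
theorem boundedNetworkSet_mono (σ : ℝ → ℝ) {L : ℕ} {n n' : Fin L → ℕ} (hn : n ≤ n') {C C' : ℝ}
    (hC : C ≤ C') : boundedNetworkSet ι σ n C ⊆ boundedNetworkSet ι σ n' C' := by
  rintro v ⟨p, hp, hpC⟩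
  exact ⟨p.pad n', by rwa [p.pad_realize hn], (p.paramNorm_pad_le n').trans (hpC.trans hC)⟩

theorem smul_mem_networkSet {σ : ℝ → ℝ} {L : ℕ} {n : Fin L → ℕ} {v : 𝒳}
    (hv : v ∈ networkSet ι σ n) (t : ℝ) : t • v ∈ networkSet ι σ n := by
  obtain ⟨p, hp⟩ := hv
  exact ⟨p.scale t, by rw [p.scale_realize]; exact hp.smul t⟩

theorem zero_mem_boundedFixedKnowledgeSet (Ψ : (Fin d → ℝ) → ℝ → ℝ) {M : ℕ} (lam : Fin M → ℝ)
    {C : ℝ} (hC : ‖lam‖ ≤ C) : (0 : 𝒳) ∈ boundedFixedKnowledgeSet ι Ψ lam C := by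
  refine ⟨0, ?_, by simpa using hC⟩
  have h0 : (fun x : Fin d → ℝ => ∑ j, (0 : Fin M → ℝ) j * Ψ x (lam j)) = 0 := by
    funext x; simp
  rw [h0]
  exact IsFunction.zero

/-- The functions with fixed knowledge-based parameters span a finite-dimensional space. -/
theorem exists_finite_span_fixedKnowledgeSet (hι : Function.Injective ι)
    {Ψ : (Fin d → ℝ) → ℝ → ℝ} {M : ℕ} {lam : Fin M → ℝ}
    (hlam : ∀ j, lam j ∈ admissibleParams ι Ψ) :
    ∃ s : Set 𝒳, s.Finite ∧ fixedKnowledgeSet ι Ψ lam ⊆ Submodule.span ℝ s := by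
  choose ψ hψ using hlam
  refine ⟨Set.range ψ, Set.finite_range ψ, ?_⟩
  rintro v ⟨c, hc⟩
  have hsum : IsFunction ι (∑ j, c j • ψ j) (fun x => ∑ j, c j * Ψ x (lam j)) := by
    have h := IsFunction.sum Finset.univ fun j _ => (hψ j).smul (c j)
    convert h using 1
    funext x
    simp
  rw [hc.unique hι hsum]
  exact Submodule.sum_mem _ fun j _ =>
    Submodule.smul_mem _ _ (Submodule.subset_span (Set.mem_range_self j))

/-- Networks of one architecture, with bounded parameters and unit norm, approximate the whole
unit sphere of a finite-dimensional space. -/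
theorem SuitableActivation.exists_uniform_approx {σ : ℝ → ℝ} {L : ℕ}
    (hσ : SuitableActivation ι σ L) {H : Type*} [NormedAddCommGroup H] [NormedSpace ℝ H]
    (T : 𝒳 →L[ℝ] H) (E : Submodule ℝ 𝒳) [FiniteDimensional ℝ E] {ε : ℝ} (hε : 0 < ε) :
    ∃ (N : Fin L → ℕ) (C : ℝ), 0 < C ∧ ∀ x ∈ E, ‖T x‖ = 1 →
      ∃ v ∈ boundedNetworkSet ι σ N C, ‖T v‖ = 1 ∧ ‖T x - T v‖ < ε := by
  -- The sphere is taken in the image of `E`, so its compactness does not need `T` to be injective.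
  have hcompact : IsCompact {y : H | y ∈ E.map (T : 𝒳 →ₗ[ℝ] H) ∧ ‖y‖ = 1} := by
    have h := (isCompact_sphere (0 : E.map (T : 𝒳 →ₗ[ℝ] H)) 1).image continuous_subtype_val
    convert h using 1
    ext y
    simp [and_comm]
  -- These open sets increase with widths and bound, so the cover is directed and compactness yields
  -- a single index.
  let U : (Fin L → ℕ) × ℝ → Set H := fun q =>
    ⋃ v ∈ {v : 𝒳 | v ∈ boundedNetworkSet ι σ q.1 q.2 ∧ ‖T v‖ = 1}, Metric.ball (T v) ε
  have hmono : Monotone U := fun q q' h => Set.biUnion_subset_biUnion_left fun v hv =>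
    ⟨boundedNetworkSet_mono σ h.1 h.2 hv.1, hv.2⟩
  have hcover : {y : H | y ∈ E.map (T : 𝒳 →ₗ[ℝ] H) ∧ ‖y‖ = 1} ⊆ ⋃ q, U q := by
    rintro _ ⟨⟨x, -, rfl⟩, hx⟩
    have hx1 : ‖T x‖ = 1 := hx
    have hx0 : ‖T x‖ ≠ 0 := by rw [hx1]; exact one_ne_zero
    -- Normalization is continuous at `x` and fixes `T x`, so a network close to `x` stays close
    -- after rescaling its output weights to unit norm.
    have hcont : ContinuousAt (fun v => ‖T v‖⁻¹ • T v) x :=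
      (T.continuous.norm.continuousAt.inv₀ hx0).smul T.continuous.continuousAt
    have hnear : ∀ᶠ v in nhds x, dist (‖T v‖⁻¹ • T v) (T x) < ε ∧ ‖T v‖ ≠ 0 := by
      refine Filter.Eventually.and ?_ (T.continuous.norm.continuousAt.eventually_ne hx0)
      have h := Metric.tendsto_nhds.1 hcont ε hε
      simpa [hx1] using h
    obtain ⟨v, ⟨hv, hv0⟩, hmem⟩ := mem_closure_iff_nhds.1 (hσ x) _ hnear
    obtain ⟨n, hn⟩ := Set.mem_iUnion.1 hmem
    obtain ⟨p, hp⟩ := smul_mem_networkSet hn ‖T v‖⁻¹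
    refine Set.mem_iUnion.2 ⟨(n, p.paramNorm), Set.mem_biUnion
      (x := ‖T v‖⁻¹ • v) ⟨⟨p, hp, le_rfl⟩, ?_⟩ ?_⟩
    · rw [map_smul, norm_smul, norm_inv, norm_norm, inv_mul_cancel₀ hv0]
    · rw [Metric.mem_ball, map_smul, dist_comm]
      exact hv
  obtain ⟨q, hq⟩ := hcompact.elim_directed_cover U
    (fun q => isOpen_biUnion fun _ _ => Metric.isOpen_ball) hcover hmono.directed_le
  refine ⟨q.1, max q.2 1, lt_max_of_lt_right one_pos, fun x hxE hx => ?_⟩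
  obtain ⟨v, ⟨hv, hv1⟩, hball⟩ := Set.mem_iUnion₂.1 (hq ⟨⟨x, hxE, rfl⟩, hx⟩)
  refine ⟨v, boundedNetworkSet_mono σ le_rfl (le_max_left _ _) hv, hv1, ?_⟩
  rw [← dist_eq_norm]
  exact hball

end Sets

theorem XGNN.IsRun.uΨ_mem_span {d : ℕ} {Ω : Set (Fin d → ℝ)} {𝒳 𝒱 𝒲 : Type*}
    [NormedAddCommGroup 𝒳] [InnerProductSpace ℝ 𝒳]
    [NormedAddCommGroup 𝒱] [InnerProductSpace ℝ 𝒱]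
    [NormedAddCommGroup 𝒲] [InnerProductSpace ℝ 𝒲]
    {ι : 𝒳 →ₗ[ℝ] ((Fin d → ℝ) →ₘ[volume.restrict Ω] ℝ)}
    {𝓛 : 𝒳 →L[ℝ] 𝒱} {𝓑 : 𝒳 →L[ℝ] 𝒲} {δ : ℝ} {f : 𝒱} {g : 𝒲}
    {σ : ℝ → ℝ} {Ψ : (Fin d → ℝ) → ℝ → ℝ} {M : ℕ} {lam : Fin M → ℝ} {k : ℕ} {R : XGNN 𝒳}
    (hR : R.IsRun ι 𝓛 𝓑 δ f g σ Ψ lam k) {E : Submodule ℝ 𝒳} (h0 : R.uΨ 0 ∈ E)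
    (hE : fixedKnowledgeSet ι Ψ lam ⊆ E) {i : ℕ} (hi : i ≤ k) : R.uΨ i ∈ E := by
  rcases Nat.eq_zero_or_pos i with rfl | hpos
  · exact h0
  refine (Submodule.span_le.2 ?_ : R.SΨ 𝓛 𝓑 δ i ≤ E) (hR.mem_SΨ i hpos hi)
  rintro _ (rfl | ⟨j, ⟨hj1, hji⟩, rfl⟩)
  · exact E.smul_mem _ h0
  · obtain ⟨c, hc, -⟩ := hR.mem_knowledge j hj1 (hji.trans hi)
    exact hE ⟨c, hc⟩

end

/-! ### The main theorem -/

theorem mainTheorem3 {d : ℕ} {Ω : Set (Fin d → ℝ)} {𝒳 𝒱 𝒲 : Type*}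
    [NormedAddCommGroup 𝒳] [InnerProductSpace ℝ 𝒳] [CompleteSpace 𝒳]
    [NormedAddCommGroup 𝒱] [InnerProductSpace ℝ 𝒱] [CompleteSpace 𝒱]
    [NormedAddCommGroup 𝒲] [InnerProductSpace ℝ 𝒲] [CompleteSpace 𝒲]
    (ι : 𝒳 →ₗ[ℝ] ((Fin d → ℝ) →ₘ[volume.restrict Ω] ℝ)) (hι : Function.Injective ι)
    (𝓛 : 𝒳 →L[ℝ] 𝒱) (𝓑 : 𝒳 →L[ℝ] 𝒲) (hwp : WellPosed 𝓛 𝓑) (δ : ℝ) (hδ : 1 ≤ δ)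
    (σ : ℝ → ℝ) (Ψ : (Fin d → ℝ) → ℝ → ℝ) {M : ℕ} (lam : Fin M → ℝ)
    (hlam : ∀ j, lam j ∈ admissibleParams ι Ψ) (ε : ℝ) (hε : 0 < ε) :
    -- the estimates hold as long as the basis functions are within `ε` of the normalized errors
    (∀ (f : 𝒱) (g : 𝒲) (u : 𝒳), IsLSSolution 𝓛 𝓑 δ f g u →
      ∀ (R : XGNN 𝒳) (k : ℕ), R.IsRun ι 𝓛 𝓑 δ f g σ Ψ lam k →
        (∀ i, 1 ≤ i → i ≤ k → R.u (i - 1) ≠ u →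
          energyNorm 𝓛 𝓑 δ (normalizedError 𝓛 𝓑 δ u (R.u (i - 1)) - R.φNN i) ≤ ε) →
        (∀ i, i ≤ k →
          energyNorm 𝓛 𝓑 δ (u - R.u i) ≤ energyNorm 𝓛 𝓑 δ (u - R.u 0) * min 1 ε ^ i) ∧
        (ε < 1 → ∀ i, 1 ≤ i → i ≤ k →
          weakResidual 𝓛 𝓑 δ f g (R.u (i - 1)) (R.φNN i) ≤
            energyNorm 𝓛 𝓑 δ (u - R.u (i - 1)) ∧
          energyNorm 𝓛 𝓑 δ (u - R.u (i - 1)) ≤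
            1 / (1 - ε) * weakResidual 𝓛 𝓑 δ f g (R.u (i - 1)) (R.φNN i))) ∧
    -- and they do hold once the networks are rich enough, where the widths and `C₁` depend only on
    -- the depth and the error of the smooth part, and `C₂` on the error of the low-regularity part
    (∀ uΨ₀ ∈ knowledgeSet ι Ψ M,
      ∃ (N : (ℓ : ℕ) → 𝒳 → Fin ℓ → ℕ) (C₁ : ℕ → 𝒳 → ℝ) (C₂ : 𝒳 → ℝ),
        (∀ ℓ e, 0 < C₁ ℓ e) ∧ (∀ e, 0 < C₂ e) ∧
        ∀ (f : 𝒱) (g : 𝒲) (u uInf uPsi : 𝒳), IsLSSolution 𝓛 𝓑 δ f g u →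
          u = uInf + uPsi → uPsi ∈ fixedKnowledgeSet ι Ψ lam →
          ∀ (R : XGNN 𝒳) (k : ℕ), R.IsRun ι 𝓛 𝓑 δ f g σ Ψ lam k → R.uΨ 0 = uΨ₀ →
            (∀ i, 1 ≤ i → i ≤ k → SuitableActivation ι σ (R.L i) ∧
              (∀ j, N (R.L i) (uInf - R.uσ (i - 1)) j ≤ R.n i j) ∧
              C₁ (R.L i) (uInf - R.uσ (i - 1)) ≤ R.C₁ i ∧
              C₂ (uPsi - R.uΨ (i - 1)) ≤ R.C₂ i) →
            (∀ i, i ≤ k →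
              energyNorm 𝓛 𝓑 δ (u - R.u i) ≤ energyNorm 𝓛 𝓑 δ (u - R.u 0) * min 1 ε ^ i) ∧
            (ε < 1 → ∀ i, 1 ≤ i → i ≤ k →
              weakResidual 𝓛 𝓑 δ f g (R.u (i - 1)) (R.φNN i) ≤
                energyNorm 𝓛 𝓑 δ (u - R.u (i - 1)) ∧
              energyNorm 𝓛 𝓑 δ (u - R.u (i - 1)) ≤
                1 / (1 - ε) * weakResidual 𝓛 𝓑 δ f g (R.u (i - 1)) (R.φNN i))) := by
  have hδ0 : 0 < δ := one_pos.trans_le hδ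
  refine ⟨fun f g u hu R k hR hclose => hR.estimates hwp hδ0 hu hε hclose, fun uΨ₀ _ => ?_⟩
  obtain ⟨s, hs, hsub⟩ := exists_finite_span_fixedKnowledgeSet hι hlam
  have happrox : ∀ (ℓ : ℕ) (e : 𝒳), ∃ (N : Fin ℓ → ℕ) (C : ℝ), 0 < C ∧
      (SuitableActivation ι σ ℓ → ∀ x ∈ Submodule.span ℝ (insert e (insert uΨ₀ s)),
        ‖energyMap 𝓛 𝓑 δ x‖ = 1 → ∃ v ∈ boundedNetworkSet ι σ N C,
          ‖energyMap 𝓛 𝓑 δ v‖ = 1 ∧ ‖energyMap 𝓛 𝓑 δ x - energyMap 𝓛 𝓑 δ v‖ < ε) := by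
    intro ℓ e
    by_cases hσ : SuitableActivation ι σ ℓ
    · have := FiniteDimensional.span_of_finite ℝ ((hs.insert uΨ₀).insert e)
      obtain ⟨N, C, hC, h⟩ := hσ.exists_uniform_approx (energyMap 𝓛 𝓑 δ)
        (Submodule.span ℝ (insert e (insert uΨ₀ s))) hε
      exact ⟨N, C, hC, fun _ => h⟩
    -- At unsuitable depths nothing is claimed, so the values are arbitrary.
    · exact ⟨0, 1, one_pos, fun h => absurd h hσ⟩
  choose N C₁ hC₁ hN using happrox
  -- The competitor has zero knowledge part, so `C₂` only has to dominate `‖lam‖`; the `1` keeps it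
  -- positive.
  refine ⟨N, C₁, fun _ => ‖lam‖ + 1, hC₁, fun _ => by positivity, ?_⟩
  intro f g u uInf uPsi hu hdecomp huPsi R k hR hinit hrich
  refine hR.estimates hwp hδ0 hu hε fun i h1 hi hne => ?_
  obtain ⟨hσ, hn, hc₁, hc₂⟩ := hrich i h1 hi
  set E := Submodule.span ℝ (insert (uInf - R.uσ (i - 1)) (insert uΨ₀ s)) with hE
  have hknow : fixedKnowledgeSet ι Ψ lam ⊆ E := hsub.trans (Submodule.span_mono
    ((Set.subset_insert _ _).trans (Set.subset_insert _ _)))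
  have hΨ0 : R.uΨ 0 ∈ E := by
    rw [hinit]
    exact Submodule.subset_span (Set.mem_insert_of_mem _ (Set.mem_insert _ _))
  have herr : u - R.u (i - 1) ∈ E := by
    have hsplit : u - R.u (i - 1) = (uInf - R.uσ (i - 1)) + (uPsi - R.uΨ (i - 1)) := by
      rw [hdecomp, XGNN.u]; abel
    rw [hsplit]
    exact E.add_mem (Submodule.subset_span (Set.mem_insert _ _))
      (E.sub_mem (hknow huPsi) (hR.uΨ_mem_span hΨ0 hknow ((Nat.sub_le i 1).trans hi)))
  -- The normalized error is a multiple of an element of `E`, the space for which the thresholds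
  -- were chosen.
  obtain ⟨v, hv, hv1, hvε⟩ := hN _ _ hσ _ (E.smul_mem _ herr)
    (XGNN.norm_energyMap_normalizedError hwp hδ0 hne)
  rw [energyNorm_eq_norm hδ0.le, map_sub]
  have hle := hR.norm_normalizedError_sub_le hwp hδ0 hu h1 hi hne
    (boundedNetworkSet_mono σ hn hc₁ hv)
    (zero_mem_boundedFixedKnowledgeSet Ψ lam ((le_add_of_nonneg_right zero_le_one).trans hc₂))
    (by rwa [add_zero])
  rw [add_zero] at hle
  exact hle.trans hvε.le
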